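/- Let $p>5$ be real and let $\ell\in\mathbb R\setminus\{0\}$. Then there exists a radial function $Z_\ell$, of class $C^2$ on $\mathbb R^3\setminus\{0\}$ (written $Z_\ell(x)=Z_\ell(r)$ with $r=|x|$), which satisfies $$\Delta Z_\ell+|Z_\ell|^{p-1}Z_\ell=0\quad\text{on }\mathbb R^3\setminus\{0\},$$ and has the following properties: there is a constant $C$ (which may depend on $p$ and $\ell$) such that $$|r\,Z_\ell(r)-\ell|\le \frac{C}{r^2}\quad\text{for all }r\ge 1,\qquad\text{and}\qquad \lim_{r\to\infty} r^2\,\frac{dZ_\ell}{dr}(r)=-\ell .$$ Furthermore, $Z_\ell\notin L^{q_p}(\mathbb R^3)$, where $q_p=\frac{3(p-1)}{2}$. -/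

import Mathlib

open Filter Topology MeasureTheory

/-- Physical space `ℝ³` with its Euclidean norm. -/
abbrev R3 : Type := EuclideanSpace ℝ (Fin 3)

/-- `Z` is a classical (`C²`) solution of `ΔZ + |Z|^(p-1) Z = 0` on `ℝ³ \ {0}`; the value of `Z` at
the origin is irrelevant. -/
structure IsPuncturedSolution (p : ℝ) (Z : R3 → ℝ) : Prop where
  contDiffOn : ContDiffOn ℝ 2 Z {0}ᶜ
  equation : ∀ x : R3, x ≠ 0 → Laplacian.laplacian Z x + |Z x| ^ (p - 1) * Z x = 0

/-- `Z` is radial on `ℝ³ \ {0}` with radial profile `z`, that is `Z(x) = z(|x|)`. Only the values of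
`z` on `(0, ∞)` matter. -/
def HasRadialProfile (Z : R3 → ℝ) (z : ℝ → ℝ) : Prop :=
  ∀ x : R3, x ≠ 0 → Z x = z ‖x‖

/-!
The inversion `ρ = 1 / r` is the natural variable. With `y(ρ) = z(1 / ρ)`, the radial equation on
`ℝ³` is `y'' = -ρ⁻⁴ |y|^(p-1) y`, and the prescribed behaviour `z ~ l / r` at infinity is the
initial condition `y(0) = 0`, `y'(0) = l`. In terms of `u = y / ρ = r z` the singular coefficient
becomes `ρ ^ (p - 4)`, continuous because `p > 5`, and the initial value problem is the fixed-point
equation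
`u(x) = l - x^(p-3) ∫₀¹ (1 - θ) θ^(p-4) |u(xθ)|^(p-1) u(xθ) dθ`.

For the nonlinearity truncated at `|u| = 2 |l|` the right-hand side is a contraction on the whole
half-line in an exponentially weighted norm (`exists_continuous_volterra`). The energy
`y'² / 2 + ρ⁻⁴ |y|^(p+1) / (p+1)` decreases from `l² / 2`, so `|y'| ≤ |l|` and hence `|u| ≤ |l|`, and
the truncation is never felt (`abs_le_of_truncated_system`). The fixed-point equation itself gives
`|u - l| ≤ C ρ^(p-3)`, which is stronger than the claimed `C / r²`.

The failure of integrability comes from the Pohozaev functional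
`Q = ρ y'² / 2 - y y' / 2 + ρ⁻³ |y|^(p+1) / (p+1)`. It vanishes at `ρ = 0`, and since `p > 5` it is
nondecreasing, so it stays above a positive constant for large `ρ`, that is, near the origin of `ℝ³`
(`exists_pohozaev_lower_bound`). On a dyadic interval `[X, 2X]`, rescaled to `[1, 2]`, a localized
virial identity bounds the rescaled functional by the scale-invariant `L^q` integral,
`q = 3 (p - 1) / 2` (`pohozaev_le_integral`). Under this rescaling `Q` is multiplied by
`X^((p-5)/(p-1))`, which tends to infinity, while the `L^q` integrals would stay bounded if the
solution were in `L^q` (`not_integrableOn_of_pohozaev_pos`).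
-/

/-! ### A contraction for a singular Volterra equation -/

open Set in
/-- The weighted sup-norm argument: in the norm `sup exp (-c |x| ^ a) |u x|` the integral operator
has Lipschitz constant `1 / 2` once `c` is large compared with the Lipschitz constant of `G`, so a
single contraction produces a solution on the whole half-line. -/
theorem exists_continuous_volterra {a : ℝ} (ha : 1 < a) (l : ℝ) {G : ℝ → ℝ} {K : NNReal}
    (hG : LipschitzWith K G) {M : ℝ} (hM : ∀ u, |G u| ≤ M) :
    ∃ u : ℝ → ℝ, Continuous u ∧ ∀ x, 0 ≤ x →
      u x = l - x ^ a * ∫ θ in (0 : ℝ)..1, (1 - θ) * θ ^ (a - 1) * G (u (x * θ)) := by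
  have ha0 : 0 < a := by linarith
  have hM0 : 0 ≤ M := (abs_nonneg _).trans (hM 0)
  -- chosen so that the `θ`-derivative of `exp (c (x θ) ^ a)` is at least twice the Lipschitz bound
  -- of the integrand
  set c : ℝ := 2 * (K + 1) / a with hc
  have hc0 : 0 < c := by positivity
  set W : ℝ → ℝ := fun x => c * |x| ^ a with hW
  have hWc : Continuous W :=
    continuous_const.mul ((Real.continuous_rpow_const ha0.le).comp continuous_abs)
  have hkc : Continuous fun θ : ℝ => (1 - θ) * θ ^ (a - 1) :=
    (continuous_const.sub continuous_id).mul (Real.continuous_rpow_const (by linarith))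
  have hk : ∀ θ ∈ Icc (0 : ℝ) 1, 0 ≤ (1 - θ) * θ ^ (a - 1) ∧ (1 - θ) * θ ^ (a - 1) ≤ 1 ∧
      (1 - θ) * θ ^ (a - 1) ≤ θ ^ (a - 1) := by
    intro θ hθ
    have h1 : 0 ≤ θ ^ (a - 1) := Real.rpow_nonneg hθ.1 _
    have h2 : θ ^ (a - 1) ≤ 1 := Real.rpow_le_one hθ.1 hθ.2 (by linarith)
    refine ⟨mul_nonneg (by linarith [hθ.2]) h1, ?_, ?_⟩ <;> nlinarith [hθ.1, hθ.2]
  let J : (BoundedContinuousFunction ℝ ℝ) → ℝ → ℝ → ℝ := fun v x θ =>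
    (1 - θ) * θ ^ (a - 1) * G (Real.exp (W (|x| * θ)) * v (|x| * θ))
  have hJ : ∀ v, Continuous (Function.uncurry (J v)) := by
    intro v
    have h1 : Continuous fun q : ℝ × ℝ => |q.1| * q.2 :=
      (continuous_abs.comp continuous_fst).mul continuous_snd
    exact (hkc.comp continuous_snd).mul (hG.continuous.comp
      ((Real.continuous_exp.comp (hWc.comp h1)).mul (v.continuous.comp h1)))
  have hJx : ∀ v x, Continuous (J v x) := fun v x =>
    (hJ v).comp (Continuous.prodMk continuous_const continuous_id)
  let T : (BoundedContinuousFunction ℝ ℝ) → ℝ → ℝ := fun v x =>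
    Real.exp (-W x) * (l - |x| ^ a * ∫ θ in (0 : ℝ)..1, J v x θ)
  have hTc : ∀ v, Continuous (T v) := by
    intro v
    refine (Real.continuous_exp.comp hWc.neg).mul (continuous_const.sub
      (((Real.continuous_rpow_const ha0.le).comp continuous_abs).mul ?_))
    exact intervalIntegral.continuous_parametric_intervalIntegral_of_continuous' (hJ v) 0 1
  have hTb : ∀ v x, ‖T v x‖ ≤ |l| + M / c := by
    intro v x
    have hI : ‖∫ θ in (0 : ℝ)..1, J v x θ‖ ≤ M * |1 - 0| := by
      refine intervalIntegral.norm_integral_le_of_norm_le_const fun θ hθ => ?_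
      rw [uIoc_of_le zero_le_one] at hθ
      obtain ⟨h1, h2, -⟩ := hk θ ⟨hθ.1.le, hθ.2⟩
      rw [Real.norm_eq_abs, abs_mul, abs_of_nonneg h1]
      nlinarith [hM (Real.exp (W (|x| * θ)) * v (|x| * θ)),
        abs_nonneg (G (Real.exp (W (|x| * θ)) * v (|x| * θ)))]
    rw [Real.norm_eq_abs] at hI ⊢
    have hX : 0 ≤ |x| ^ a := by positivity
    have hE1 : Real.exp (-W x) ≤ 1 := Real.exp_le_one_iff.2 (neg_nonpos.2 (by positivity))
    have hE2 : Real.exp (-W x) * |x| ^ a ≤ 1 / c := by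
      rw [le_div_iff₀ hc0, Real.exp_neg, inv_mul_eq_div, div_mul_eq_mul_div,
        div_le_one (Real.exp_pos _)]
      have := Real.add_one_le_exp (W x)
      have h3 : W x = c * |x| ^ a := rfl
      linarith
    have hE0 := Real.exp_pos (-W x)
    calc |T v x| ≤ Real.exp (-W x) * (|l| + |x| ^ a * M) := by
          simp only [T]
          rw [abs_mul, abs_of_pos hE0]
          gcongr
          refine (abs_sub _ _).trans ?_
          rw [abs_mul, abs_of_nonneg hX]
          gcongr
          simpa using hI
      _ = Real.exp (-W x) * |l| + Real.exp (-W x) * |x| ^ a * M := by ring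
      _ ≤ 1 * |l| + 1 / c * M := by gcongr
      _ = |l| + M / c := by ring
  let F : (BoundedContinuousFunction ℝ ℝ) → (BoundedContinuousFunction ℝ ℝ) := fun v =>
    BoundedContinuousFunction.ofNormedAddCommGroup (T v) (hTc v) _ (hTb v)
  have hF : ContractingWith (1 / 2) F := by
    refine ⟨by norm_num, LipschitzWith.of_dist_le_mul fun v w => ?_⟩
    rw [BoundedContinuousFunction.dist_le (by positivity)]
    intro x
    change |T v x - T w x| ≤ _
    set d := dist v w with hd
    have hd0 : 0 ≤ d := dist_nonneg
    set X := |x| with hXdef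
    have hX0 : 0 ≤ X := abs_nonneg x
    -- the primitive that absorbs the weight
    have hder : ∀ θ ∈ uIcc (0 : ℝ) 1, HasDerivAt (fun θ => Real.exp (c * X ^ a * θ ^ a))
        (Real.exp (c * X ^ a * θ ^ a) * (c * X ^ a * (a * θ ^ (a - 1)))) θ := fun θ _ =>
      ((Real.hasDerivAt_rpow_const (Or.inr ha.le)).const_mul _).exp
    have hpc : Continuous fun θ : ℝ =>
        Real.exp (c * X ^ a * θ ^ a) * (c * X ^ a * (a * θ ^ (a - 1))) :=
      (Real.continuous_exp.comp (continuous_const.mul (Real.continuous_rpow_const ha0.le))).mul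
        (continuous_const.mul (continuous_const.mul (Real.continuous_rpow_const (by linarith))))
    have hFTC := intervalIntegral.integral_eq_sub_of_hasDerivAt hder (hpc.intervalIntegrable 0 1)
    have hdiff : T v x - T w x =
        -(Real.exp (-W x) * ∫ θ in (0 : ℝ)..1, X ^ a * (J v x θ - J w x θ)) := by
      rw [intervalIntegral.integral_const_mul, intervalIntegral.integral_sub
        ((hJx v x).intervalIntegrable _ _) ((hJx w x).intervalIntegrable _ _)]
      simp only [T]
      ring
    have hle : |∫ θ in (0 : ℝ)..1, X ^ a * (J v x θ - J w x θ)| ≤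
        ∫ θ in (0 : ℝ)..1, d / 2 *
          (Real.exp (c * X ^ a * θ ^ a) * (c * X ^ a * (a * θ ^ (a - 1)))) := by
      rw [← Real.norm_eq_abs]
      refine intervalIntegral.norm_integral_le_of_norm_le zero_le_one
        (Eventually.of_forall fun θ hθ => ?_) ((continuous_const.mul hpc).intervalIntegrable _ _)
      obtain ⟨h1, h2, h3⟩ := hk θ ⟨hθ.1.le, hθ.2⟩
      have hWe : W (X * θ) = c * X ^ a * θ ^ a := by
        simp only [hW]
        rw [abs_of_nonneg (mul_nonneg hX0 hθ.1.le), Real.mul_rpow hX0 hθ.1.le]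
        ring
      have hvw : |v (X * θ) - w (X * θ)| ≤ d := by
        have := BoundedContinuousFunction.dist_coe_le_dist (f := v) (g := w) (X * θ)
        rwa [Real.dist_eq] at this
      have hL := hG.dist_le_mul (Real.exp (W (X * θ)) * v (X * θ))
        (Real.exp (W (X * θ)) * w (X * θ))
      rw [Real.dist_eq, Real.dist_eq, ← mul_sub, abs_mul, abs_of_pos (Real.exp_pos _), hWe] at hL
      have hXa : 0 ≤ X ^ a := by positivity
      have hθa : 0 ≤ θ ^ (a - 1) := Real.rpow_nonneg hθ.1.le _
      have hca : c * a = 2 * (K + 1) := by rw [hc]; field_simp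
      simp only [J]
      rw [← mul_sub, Real.norm_eq_abs, abs_mul, abs_mul, abs_of_nonneg hXa, abs_of_nonneg h1, hWe]
      calc X ^ a * ((1 - θ) * θ ^ (a - 1) * _)
          ≤ X ^ a * (θ ^ (a - 1) * (K * (Real.exp (c * X ^ a * θ ^ a) * d))) := by
            refine mul_le_mul_of_nonneg_left (mul_le_mul h3 (hL.trans ?_) (abs_nonneg _) hθa) hXa
            gcongr
        _ ≤ X ^ a * (θ ^ (a - 1) * ((K + 1) * (Real.exp (c * X ^ a * θ ^ a) * d))) := by
            gcongr
            linarith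
        _ = d / 2 * (Real.exp (c * X ^ a * θ ^ a) * (X ^ a * (c * a * θ ^ (a - 1)))) := by
            rw [hca]; ring
        _ = _ := by ring
    rw [intervalIntegral.integral_const_mul (d / 2), hFTC] at hle
    simp only [Real.one_rpow, mul_one, Real.zero_rpow ha0.ne', mul_zero, Real.exp_zero] at hle
    have hWx : W x = c * X ^ a := rfl
    have hE0 := Real.exp_pos (-W x)
    have hEE : Real.exp (-W x) * Real.exp (c * X ^ a) = 1 := by
      rw [hWx, ← Real.exp_add]; simp
    rw [hdiff, abs_neg, abs_mul, abs_of_pos hE0]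
    calc _ ≤ Real.exp (-W x) * (d / 2 * (Real.exp (c * X ^ a) - 1)) := by gcongr
      _ = d / 2 * (Real.exp (-W x) * Real.exp (c * X ^ a)) - d / 2 * Real.exp (-W x) := by ring
      _ ≤ d / 2 := by rw [hEE]; nlinarith
      _ = _ := by push_cast; ring
  set v := ContractingWith.fixedPoint F hF with hv
  have hfix : F v = v := hF.fixedPoint_isFixedPt
  refine ⟨fun x => Real.exp (W x) * v x, (Real.continuous_exp.comp hWc).mul v.continuous, ?_⟩
  intro x hx
  have h1 : v x = T v x := (DFunLike.congr_fun hfix x).symm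
  simp only [T, J, abs_of_nonneg hx] at h1
  simp only
  rw [h1, ← mul_assoc, ← Real.exp_add, add_neg_cancel, Real.exp_zero, one_mul]

/-! ### The inverted system and its energy -/

theorem hasDerivAt_abs_rpow_div {p : ℝ} (hp : 1 < p) (t : ℝ) :
    HasDerivAt (fun t : ℝ => |t| ^ (p + 1) / (p + 1)) (|t| ^ (p - 1) * t) t := by
  refine ((hasDerivAt_abs_rpow t (by linarith : 1 < p + 1)).div_const (p + 1)).congr_deriv ?_
  have : p + 1 ≠ 0 := by linarith
  rw [show p + 1 - 2 = p - 1 by ring]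
  field_simp

theorem abs_rpow_sub_one_mul_mul_self {p : ℝ} (hp : 1 < p) (t : ℝ) :
    |t| ^ (p - 1) * t * t = |t| ^ (p + 1) := by
  rcases eq_or_ne t 0 with rfl | ht
  · simp [Real.zero_rpow (by linarith : p + 1 ≠ 0)]
  · rw [mul_assoc, ← abs_mul_abs_self t, ← sq, ← Real.rpow_natCast |t| 2,
      ← Real.rpow_add (abs_pos.2 ht)]
    congr 1
    norm_num
    ring

/-- With `ρ = 1 / r` and `u = r z(r)`, and with `η = d(ρ u)/dρ`, the radial equation becomes this
first-order system. The predicate is pointwise in `ρ`, so that it can be asserted on any set. -/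
structure InvertedSystemAt (p : ℝ) (u η : ℝ → ℝ) (ρ : ℝ) : Prop where
  left : HasDerivAt u ((η ρ - u ρ) / ρ) ρ
  right : HasDerivAt η (-(ρ ^ (p - 4) * (|u ρ| ^ (p - 1) * u ρ))) ρ

/-- The energy of the inverted system; it is dissipated as `ρ` grows. -/
noncomputable def invertedEnergy (p : ℝ) (u η : ℝ → ℝ) (ρ : ℝ) : ℝ :=
  η ρ ^ 2 / 2 + ρ ^ (p - 3) * (|u ρ| ^ (p + 1) / (p + 1))

theorem InvertedSystemAt.hasDerivAt_energy {p : ℝ} (hp : 1 < p) {u η : ℝ → ℝ} {ρ : ℝ} (hρ : 0 < ρ)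
    (h : InvertedSystemAt p u η ρ) :
    HasDerivAt (invertedEnergy p u η)
      (-(4 / (p + 1) * ρ ^ (p - 4) * |u ρ| ^ (p + 1))) ρ := by
  have h1 := (h.right.pow 2).div_const 2
  have h2 := (Real.hasDerivAt_rpow_const (p := p - 3) (Or.inl hρ.ne')).mul
    ((hasDerivAt_abs_rpow_div hp (u ρ)).comp ρ h.left)
  refine (h1.add h2).congr_deriv ?_
  have h3 : ρ ^ (p - 3) = ρ ^ (p - 4) * ρ := by
    rw [← Real.rpow_add_one hρ.ne']; ring_nf
  have hp1 : p + 1 ≠ 0 := by linarith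
  simp only [Function.comp, Nat.cast_ofNat]
  rw [← abs_rpow_sub_one_mul_mul_self hp, h3, show p - 3 - 1 = p - 4 by ring]
  field_simp
  ring

/-! ### Global solutions by truncation -/

/-- The nonlinearity `|t| ^ (p - 1) * t` with `t` truncated to `[-B, B]`, which makes it bounded and
globally Lipschitz. -/
noncomputable def truncatedPower (p B t : ℝ) : ℝ :=
  |max (-B) (min B t)| ^ (p - 1) * max (-B) (min B t)

theorem truncatedPower_of_abs_le {p B t : ℝ} (h : |t| ≤ B) :
    truncatedPower p B t = |t| ^ (p - 1) * t := by
  obtain ⟨h1, h2⟩ := abs_le.1 h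
  rw [truncatedPower, min_eq_right h2, max_eq_right h1]

theorem abs_truncatedPower_le {p B : ℝ} (hp : 1 < p) (hB : 0 ≤ B) (t : ℝ) :
    |truncatedPower p B t| ≤ B ^ (p - 1) * B := by
  have h : |max (-B) (min B t)| ≤ B :=
    abs_le.2 ⟨le_max_left _ _, max_le (by linarith) (min_le_left _ _)⟩
  rw [truncatedPower, abs_mul, abs_of_nonneg (Real.rpow_nonneg (abs_nonneg _) _)]
  exact mul_le_mul (Real.rpow_le_rpow (abs_nonneg _) h (by linarith)) h (abs_nonneg _)
    (Real.rpow_nonneg hB _)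

theorem exists_lipschitzWith_truncatedPower {p B : ℝ} (hp : 2 < p) (hB : 0 ≤ B) :
    ∃ K, LipschitzWith K (truncatedPower p B) := by
  have hg : ContDiff ℝ 1 fun t : ℝ => |t| ^ (p - 1) * t := by
    have h : ContDiff ℝ 1 fun t : ℝ => ‖t‖ ^ (p - 1) := contDiff_norm_rpow (by linarith)
    exact h.mul contDiff_id
  obtain ⟨K, hK⟩ := hg.contDiffOn.exists_lipschitzOnWith one_ne_zero (convex_Icc (-B) B)
    isCompact_Icc
  have hcl : LipschitzWith 1 fun t : ℝ => max (-B) (min B t) :=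
    (LipschitzWith.id.const_min B).const_max (-B)
  exact ⟨K * 1, lipschitzOnWith_univ.1 (hK.comp hcl.lipschitzOnWith fun t _ =>
    ⟨le_max_left _ _, max_le (by linarith) (min_le_left _ _)⟩)⟩

/-- Rewriting the averaged integral operator as a double primitive: `x u` solves
`y'' = -x ^ (a - 1) G (u)`. -/
theorem mul_eq_double_primitive {a l : ℝ} (ha : 1 < a) {G u : ℝ → ℝ} (hG : Continuous G)
    (hu : Continuous u) {x : ℝ} (hx : 0 ≤ x)
    (h : u x = l - x ^ a * ∫ θ in (0 : ℝ)..1, (1 - θ) * θ ^ (a - 1) * G (u (x * θ))) :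
    x * u x = l * x - x * (∫ s in (0 : ℝ)..x, s ^ (a - 1) * G (u s)) +
      ∫ s in (0 : ℝ)..x, s * (s ^ (a - 1) * G (u s)) := by
  rcases hx.eq_or_lt with rfl | hx0
  · simp
  have hc : Continuous fun s : ℝ => s ^ (a - 1) * G (u s) :=
    (Real.continuous_rpow_const (by linarith)).mul (hG.comp hu)
  have hsub := intervalIntegral.smul_integral_comp_mul_left (a := 0) (b := 1)
    (fun s => (x - s) * (s ^ (a - 1) * G (u s))) x
  have hcomb : ∫ s in (0 : ℝ)..x, (x - s) * (s ^ (a - 1) * G (u s)) =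
      x * (∫ s in (0 : ℝ)..x, s ^ (a - 1) * G (u s)) -
        ∫ s in (0 : ℝ)..x, s * (s ^ (a - 1) * G (u s)) := by
    have h1 : Continuous fun s : ℝ => x * (s ^ (a - 1) * G (u s)) := continuous_const.mul hc
    have h2 : Continuous fun s : ℝ => s * (s ^ (a - 1) * G (u s)) := continuous_id.mul hc
    rw [← intervalIntegral.integral_const_mul, ← intervalIntegral.integral_sub
      (h1.intervalIntegrable _ _) (h2.intervalIntegrable _ _)]
    simp only [sub_mul]
  have hkern : ∫ θ in (0 : ℝ)..1, (x - x * θ) * ((x * θ) ^ (a - 1) * G (u (x * θ))) =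
      x ^ a * ∫ θ in (0 : ℝ)..1, (1 - θ) * θ ^ (a - 1) * G (u (x * θ)) := by
    rw [← intervalIntegral.integral_const_mul]
    refine intervalIntegral.integral_congr fun θ hθ => ?_
    rw [Set.uIcc_of_le zero_le_one] at hθ
    rw [Real.mul_rpow hx hθ.1, show x ^ a = x ^ (a - 1) * x by
      rw [← Real.rpow_add_one hx0.ne']; ring_nf]
    ring
  simp only [smul_eq_mul, mul_zero, mul_one] at hsub
  rw [hcomb, hkern] at hsub
  rw [h]
  linarith

theorem contDiff_two_of_hasDerivAt {y η h : ℝ → ℝ} (h1 : ∀ x, HasDerivAt y (η x) x)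
    (h2 : ∀ x, HasDerivAt η (h x) x) (hc : Continuous h) : ContDiff ℝ 2 y := by
  have hη : ContDiff ℝ 1 η := by
    rw [contDiff_one_iff_deriv, funext fun x => (h2 x).deriv]
    exact ⟨fun x => (h2 x).differentiableAt, hc⟩
  rw [show (2 : WithTop ℕ∞) = 1 + 1 by norm_num, contDiff_succ_iff_deriv,
    funext fun x => (h1 x).deriv]
  exact ⟨fun x => (h1 x).differentiableAt, fun h => absurd h (by simp), hη⟩

open Set in
/-- The a priori bound that makes the truncation at `2 |l|` inactive. Up to the first point where
`|u| = 2 |l|` the energy decreases, hence `|η| ≤ |l|` and so `|u| ≤ |l|` there. -/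
theorem abs_le_of_truncated_system {p l : ℝ} (hp : 5 < p) (hl : l ≠ 0) {u y η : ℝ → ℝ}
    (hu : Continuous u) (hη : Continuous η) (hy : ∀ x, HasDerivAt y (η x) x)
    (hyu : ∀ x, 0 ≤ x → y x = x * u x) (hη0 : η 0 = l) (hu0 : u 0 = l)
    (hsys : ∀ x, 0 < x → |u x| ≤ 2 * |l| → InvertedSystemAt p u η x) :
    ∀ x, 0 ≤ x → |u x| ≤ |l| := by
  have hlpos : 0 < |l| := abs_pos.2 hl
  have hEc : Continuous (invertedEnergy p u η) := by
    refine ((hη.pow 2).div_const 2).add ((Real.continuous_rpow_const (by linarith)).mul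
      (((Real.continuous_rpow_const (by linarith)).comp hu.abs).div_const _))
  have hE0 : invertedEnergy p u η 0 = l ^ 2 / 2 := by
    simp [invertedEnergy, hη0, Real.zero_rpow (by linarith : p - 3 ≠ 0)]
  have key : ∀ X, 0 < X → (∀ x ∈ Icc 0 X, |u x| ≤ 2 * |l|) → |u X| ≤ |l| := by
    intro X hX hb
    have hd : ∀ x ∈ Ioo 0 X, HasDerivAt (invertedEnergy p u η)
        (-(4 / (p + 1) * x ^ (p - 4) * |u x| ^ (p + 1))) x := fun x hx =>
      (hsys x hx.1 (hb x ⟨hx.1.le, hx.2.le⟩)).hasDerivAt_energy (by linarith) hx.1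
    have hanti : AntitoneOn (invertedEnergy p u η) (Icc 0 X) := by
      refine antitoneOn_of_deriv_nonpos (convex_Icc _ _) hEc.continuousOn ?_ ?_
      · rw [interior_Icc]
        exact fun x hx => (hd x hx).differentiableAt.differentiableWithinAt
      · rw [interior_Icc]
        intro x hx
        rw [(hd x hx).deriv]
        have : 0 < p + 1 := by linarith
        have := Real.rpow_nonneg hx.1.le (p - 4)
        rw [neg_nonpos]
        positivity
    have hηb : ∀ x ∈ Icc 0 X, |η x| ≤ |l| := by
      intro x hx
      have h1 := hanti (left_mem_Icc.2 hX.le) hx hx.1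
      rw [hE0, invertedEnergy] at h1
      have : 0 < p + 1 := by linarith
      have h2 : 0 ≤ x ^ (p - 3) * (|u x| ^ (p + 1) / (p + 1)) :=
        mul_nonneg (Real.rpow_nonneg hx.1 _) (by positivity)
      exact sq_le_sq.1 (by linarith)
    have hmv := (convex_Icc (0 : ℝ) X).norm_image_sub_le_of_norm_hasDerivWithin_le
      (fun x _ => (hy x).hasDerivWithinAt) hηb (left_mem_Icc.2 hX.le) (right_mem_Icc.2 hX.le)
    rw [hyu X hX.le, hyu 0 le_rfl, zero_mul, sub_zero, sub_zero, Real.norm_eq_abs, Real.norm_eq_abs,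
      abs_mul, abs_of_pos hX, mul_comm] at hmv
    exact le_of_mul_le_mul_right hmv hX
  have hbound : ∀ x, 0 ≤ x → |u x| ≤ 2 * |l| := by
    by_contra! hcon
    obtain ⟨x₁, hx₁, hx₁u⟩ := hcon
    set S : Set ℝ := {x | 0 ≤ x ∧ 2 * |l| ≤ |u x|} with hS
    have hSc : IsClosed S := (isClosed_le continuous_const continuous_id).inter
      (isClosed_le continuous_const hu.abs)
    have hSb : BddBelow S := ⟨0, fun x hx => hx.1⟩
    have hm := hSc.csInf_mem ⟨x₁, hx₁, hx₁u.le⟩ hSb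
    set m := sInf S with hmdef
    have hlt : ∀ x, 0 ≤ x → x < m → |u x| < 2 * |l| := by
      intro x hx hxm
      by_contra! h
      exact absurd (csInf_le hSb ⟨hx, h⟩) (not_le.2 hxm)
    have hm0 : 0 < m := by
      refine hm.1.lt_of_ne fun h => ?_
      have := hm.2
      rw [← h, hu0] at this
      linarith
    have hle : |u m| ≤ 2 * |l| := by
      have h1 : Tendsto (fun x => |u x|) (𝓝[<] m) (𝓝 |u m|) :=
        hu.abs.continuousAt.tendsto.mono_left nhdsWithin_le_nhds
      refine le_of_tendsto h1 ?_
      filter_upwards [Ioo_mem_nhdsLT hm0] with x hx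
      exact (hlt x hx.1.le hx.2).le
    have := key m hm0 fun x hx => by
      rcases hx.2.eq_or_lt with h | h
      · rw [h]; exact hle
      · exact (hlt x hx.1 h).le
    linarith [hm.2]
  intro x hx
  rcases hx.eq_or_lt with rfl | hx0
  · rw [hu0]
  · exact key x hx0 fun s hs => hbound s hs.1

/-- The solution of the inverted system on the whole half-line issuing from `u(0) = η(0) = l`. -/
theorem exists_inverted_solution {p l : ℝ} (hp : 5 < p) (hl : l ≠ 0) :
    ∃ u y η : ℝ → ℝ, Continuous u ∧ ContDiff ℝ 2 y ∧ (∀ x, HasDerivAt y (η x) x) ∧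
      Continuous η ∧ (∀ x, 0 ≤ x → y x = x * u x) ∧ u 0 = l ∧ η 0 = l ∧
      (∀ x, 0 < x → InvertedSystemAt p u η x) ∧
      ∃ C, ∀ x, 0 ≤ x → |u x - l| ≤ C * x ^ (p - 3) := by
  have hB : 0 ≤ 2 * |l| := by positivity
  obtain ⟨K, hK⟩ := exists_lipschitzWith_truncatedPower (by linarith : 2 < p) hB
  have hM := abs_truncatedPower_le (by linarith : 1 < p) hB
  set G := truncatedPower p (2 * |l|) with hG
  set M := (2 * |l|) ^ (p - 1) * (2 * |l|) with hMdef
  obtain ⟨u, hu, hfix⟩ := exists_continuous_volterra (by linarith : 1 < p - 3) l hK hM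
  have he : p - 3 - 1 = p - 4 := by ring
  set h : ℝ → ℝ := fun s => s ^ (p - 4) * G (u s) with hh
  have hc : Continuous h := (Real.continuous_rpow_const (by linarith)).mul (hK.continuous.comp hu)
  set η : ℝ → ℝ := fun x => l - ∫ s in (0 : ℝ)..x, h s with hηdef
  set y : ℝ → ℝ := fun x => l * x - x * (∫ s in (0 : ℝ)..x, h s) + ∫ s in (0 : ℝ)..x, s * h s
    with hydef
  have hη : ∀ x, HasDerivAt η (-h x) x := fun x =>
    (hc.integral_hasStrictDerivAt 0 x).hasDerivAt.const_sub l
  have hy : ∀ x, HasDerivAt y (η x) x := by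
    intro x
    have h1 := (hc.integral_hasStrictDerivAt 0 x).hasDerivAt
    have h2 := ((continuous_id.mul hc).integral_hasStrictDerivAt 0 x).hasDerivAt
    refine ((((hasDerivAt_id x).const_mul l).sub ((hasDerivAt_id x).mul h1)).add h2).congr_deriv ?_
    simp only [id, Pi.mul_apply, hηdef]
    ring
  have hηc : Continuous η := continuous_iff_continuousAt.2 fun x => (hη x).continuousAt
  have hyu : ∀ x, 0 ≤ x → y x = x * u x := by
    intro x hx
    have := mul_eq_double_primitive (by linarith : 1 < p - 3) hK.continuous hu hx (hfix x hx)
    rw [he] at this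
    exact this.symm
  have hu0 : u 0 = l := by
    rw [hfix 0 le_rfl, Real.zero_rpow (by linarith : p - 3 ≠ 0)]
    simp
  have hη0 : η 0 = l := by simp [hηdef]
  have hsys : ∀ x, 0 < x → |u x| ≤ 2 * |l| → InvertedSystemAt p u η x := by
    intro x hx hb
    constructor
    · have h1 : HasDerivAt (fun x => y x / x) _ x := (hy x).div (hasDerivAt_id x) hx.ne'
      have h2 : u =ᶠ[𝓝 x] fun x => y x / x := by
        filter_upwards [lt_mem_nhds hx] with s hs
        rw [hyu s hs.le]
        field_simp
      refine (h1.congr_of_eventuallyEq h2).congr_deriv ?_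
      rw [hyu x hx.le]
      field_simp
    · have := hη x
      simp only [hh, hG, truncatedPower_of_abs_le hb] at this
      exact this
  have hbound := abs_le_of_truncated_system hp hl hu hηc hy hyu hη0 hu0 hsys
  refine ⟨u, y, η, hu, contDiff_two_of_hasDerivAt hy hη hc.neg, hy, hηc, hyu, hu0, hη0,
    fun x hx => hsys x hx ((hbound x hx.le).trans (by linarith [abs_nonneg l])), M, ?_⟩
  intro x hx
  rw [hfix x hx, sub_sub_cancel_left, abs_neg, abs_mul,
    abs_of_nonneg (Real.rpow_nonneg hx _), mul_comm]
  refine mul_le_mul_of_nonneg_right ?_ (Real.rpow_nonneg hx _)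
  have hI := intervalIntegral.norm_integral_le_of_norm_le_const (a := 0) (b := 1) (C := M)
    (f := fun θ => (1 - θ) * θ ^ (p - 3 - 1) * G (u (x * θ))) fun θ hθ => by
      rw [Set.uIoc_of_le zero_le_one] at hθ
      have h1 : 0 ≤ θ ^ (p - 3 - 1) := Real.rpow_nonneg hθ.1.le _
      have h2 : θ ^ (p - 3 - 1) ≤ 1 := Real.rpow_le_one hθ.1.le hθ.2 (by linarith)
      have h3 : 0 ≤ 1 - θ := by linarith [hθ.2]
      rw [Real.norm_eq_abs, abs_mul, abs_of_nonneg (mul_nonneg h3 h1)]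
      have h4 : (1 - θ) * θ ^ (p - 3 - 1) ≤ 1 := mul_le_one₀ (by linarith [hθ.1]) h1 h2
      calc _ ≤ 1 * M := mul_le_mul h4 (hM _) (abs_nonneg _) zero_le_one
        _ = M := one_mul M
  simpa using hI

/-! ### Radial Laplacians on `ℝ³` -/

/-- The Laplacian of `φ (‖x‖ ^ 2)` on `ℝ³`, for `φ` twice differentiable at `‖x‖ ^ 2`. Writing
the radial variable as `‖x‖ ^ 2` keeps the inner function polynomial. -/
theorem laplacian_comp_norm_sq {φ φ' : ℝ → ℝ} {φ'' : ℝ} {x : R3}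
    (h1 : ∀ᶠ s in 𝓝 (‖x‖ ^ 2), HasDerivAt φ (φ' s) s) (h2 : HasDerivAt φ' φ'' (‖x‖ ^ 2)) :
    Laplacian.laplacian (fun y : R3 => φ (‖y‖ ^ 2)) x =
      4 * ‖x‖ ^ 2 * φ'' + 6 * φ' (‖x‖ ^ 2) := by
  have hN : ∀ y : R3, HasFDerivAt (fun y : R3 => ‖y‖ ^ 2) ((2 : ℝ) • innerSL ℝ y) y := fun y =>
    (hasStrictFDerivAt_norm_sq y).hasFDerivAt.congr_fderiv (by ext; simp)
  have hcont : ContinuousAt (fun y : R3 => ‖y‖ ^ 2) x := by fun_prop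
  have hF : fderiv ℝ (fun y : R3 => φ (‖y‖ ^ 2)) =ᶠ[𝓝 x]
      fun y => φ' (‖y‖ ^ 2) • ((2 : ℝ) • innerSL ℝ y) := by
    filter_upwards [hcont.eventually h1] with y hy
    exact (hy.comp_hasFDerivAt y (hN y)).fderiv
  -- over `ℝ` the conjugate-linear map `innerSL` is linear
  let B : R3 →L[ℝ] R3 →L[ℝ] ℝ := LinearMap.toContinuousLinearMap
    { toFun := fun y => innerSL ℝ y
      map_add' := fun y z => by simp
      map_smul' := fun t y => by simp }
  have hF2 : HasFDerivAt (fun y : R3 => φ' (‖y‖ ^ 2) • ((2 : ℝ) • innerSL ℝ y))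
      (φ' (‖x‖ ^ 2) • ((2 : ℝ) • B) +
        (φ'' • ((2 : ℝ) • innerSL ℝ x)).smulRight ((2 : ℝ) • innerSL ℝ x)) x := by
    have ha : HasFDerivAt (fun y : R3 => φ' (‖y‖ ^ 2)) (φ'' • ((2 : ℝ) • innerSL ℝ x)) x :=
      h2.comp_hasFDerivAt x (hN x)
    have hb : HasFDerivAt (fun y : R3 => (2 : ℝ) • innerSL ℝ y) ((2 : ℝ) • B) x :=
      (B.hasFDerivAt (x := x)).const_smul (2 : ℝ)
    exact ha.smul hb
  rw [InnerProductSpace.laplacian_eq_iteratedFDeriv_orthonormalBasis _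
    (EuclideanSpace.basisFun (Fin 3) ℝ)]
  simp only [iteratedFDeriv_two_apply]
  rw [hF.fderiv_eq, hF2.fderiv]
  rw [EuclideanSpace.norm_sq_eq]
  simp [B, Fin.sum_univ_three, EuclideanSpace.inner_single_right]
  ring

/-- The Kelvin-type inversion `r = 1 / ρ` turns the radial Laplacian on `ℝ³` into
`ρ ^ 4 * y''(ρ)`: there is no first-order term. -/
theorem laplacian_comp_norm_inv {y η : ℝ → ℝ} {η' : ℝ} {x : R3} (hx : x ≠ 0)
    (h1 : ∀ ρ, HasDerivAt y (η ρ) ρ) (h2 : HasDerivAt η η' ‖x‖⁻¹) :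
    Laplacian.laplacian (fun w : R3 => y ‖w‖⁻¹) x = ‖x‖⁻¹ ^ 4 * η' := by
  have hx0 : 0 < ‖x‖ := norm_pos_iff.2 hx
  have hs0 : 0 < ‖x‖ ^ 2 := by positivity
  have hfun : (fun w : R3 => y ‖w‖⁻¹) = fun w : R3 => (fun s => y (Real.sqrt s)⁻¹) (‖w‖ ^ 2) := by
    funext w
    simp [Real.sqrt_sq (norm_nonneg w)]
  have hinv : ∀ s : ℝ, 0 < s → HasDerivAt (fun s => (Real.sqrt s)⁻¹)
      (-(1 / 2) * (Real.sqrt s)⁻¹ ^ 3) s := by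
    intro s hs
    have hq := Real.sqrt_pos.2 hs
    refine ((Real.hasDerivAt_sqrt hs.ne').inv hq.ne').congr_deriv ?_
    field_simp
  have hsq : Real.sqrt (‖x‖ ^ 2) = ‖x‖ := Real.sqrt_sq (norm_nonneg x)
  rw [hfun, laplacian_comp_norm_sq
    (φ := fun s => y (Real.sqrt s)⁻¹)
    (φ' := fun s => η (Real.sqrt s)⁻¹ * (-(1 / 2) * (Real.sqrt s)⁻¹ ^ 3))
    (φ'' := η' * (-(1 / 2) * ‖x‖⁻¹ ^ 3) * (-(1 / 2) * ‖x‖⁻¹ ^ 3) +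
      η ‖x‖⁻¹ * (-(1 / 2) * (3 * ‖x‖⁻¹ ^ 2 * (-(1 / 2) * ‖x‖⁻¹ ^ 3))))]
  · simp only [hsq]
    field_simp
    ring
  · filter_upwards [lt_mem_nhds hs0] with s hs
    exact (h1 _).comp s (hinv s hs)
  · have hi := hinv _ hs0
    rw [hsq] at hi
    have h2' : HasDerivAt η η' ((fun s => (Real.sqrt s)⁻¹) (‖x‖ ^ 2)) := by simpa only [hsq]
    have ha := HasDerivAt.comp (‖x‖ ^ 2) h2' hi
    have hb := ((hi.pow 3).const_mul (-(1 / 2) : ℝ))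
    refine (ha.mul hb).congr_deriv ?_
    simp only [Function.comp, Pi.pow_apply, hsq]
    norm_num

/-! ### The Pohozaev functional and non-integrability -/

/-- The Pohozaev functional `ρ y'² / 2 - y y' / 2 + ρ ^ (-3) |y| ^ (p + 1) / (p + 1)` of `y = ρ u`,
written in terms of `u` and `η = y'`. -/
noncomputable def pohozaev (p : ℝ) (u η : ℝ → ℝ) (ρ : ℝ) : ℝ :=
  ρ * η ρ ^ 2 / 2 - ρ * u ρ * η ρ / 2 + ρ ^ (p - 2) * (|u ρ| ^ (p + 1) / (p + 1))

/-- The sign of the derivative is where supercriticality `5 < p` enters. -/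
theorem InvertedSystemAt.hasDerivAt_pohozaev {p : ℝ} (hp : 1 < p) {u η : ℝ → ℝ} {ρ : ℝ}
    (hρ : 0 < ρ) (h : InvertedSystemAt p u η ρ) :
    HasDerivAt (pohozaev p u η)
      ((p - 5) / (2 * (p + 1)) * (ρ ^ (p - 3) * |u ρ| ^ (p + 1))) ρ := by
  have h1 := ((hasDerivAt_id ρ).mul (h.right.pow 2)).div_const 2
  have h2 := (((hasDerivAt_id ρ).mul h.left).mul h.right).div_const 2
  have h3 := (Real.hasDerivAt_rpow_const (p := p - 2) (Or.inl hρ.ne')).mul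
    ((hasDerivAt_abs_rpow_div hp (u ρ)).comp ρ h.left)
  refine ((h1.sub h2).add h3).congr_deriv ?_
  have e3 : ρ ^ (p - 3) = ρ ^ (p - 4) * ρ := by
    rw [← Real.rpow_add_one hρ.ne']; ring_nf
  have e2 : ρ ^ (p - 2) = ρ ^ (p - 4) * ρ * ρ := by
    rw [← Real.rpow_add_one hρ.ne', ← Real.rpow_add_one hρ.ne']; ring_nf
  have hp1 : p + 1 ≠ 0 := by linarith
  rw [e2, e3, show p - 2 - 1 = p - 3 by ring, e3]
  simp only [Function.comp, Nat.cast_ofNat, id, Pi.mul_apply, Pi.pow_apply]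
  rw [← abs_rpow_sub_one_mul_mul_self hp]
  field_simp
  ring

open Set in
/-- The functional vanishes at the origin and is nondecreasing, hence stays above a positive
constant. -/
theorem exists_pohozaev_lower_bound {p l : ℝ} (hp : 5 < p) (hl : l ≠ 0) {u η : ℝ → ℝ}
    (hu : Continuous u) (hη : Continuous η) (hu0 : u 0 = l)
    (hsys : ∀ x, 0 < x → InvertedSystemAt p u η x) :
    ∃ c x₀, 0 < c ∧ 0 < x₀ ∧ ∀ x, x₀ ≤ x → c ≤ pohozaev p u η x := by
  have hQc : Continuous (pohozaev p u η) := by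
    refine (((continuous_id.mul (hη.pow 2)).div_const 2).sub
      (((continuous_id.mul hu).mul hη).div_const 2)).add
      ((Real.continuous_rpow_const (by linarith)).mul
      (((Real.continuous_rpow_const (by linarith)).comp hu.abs).div_const _))
  have hQ0 : pohozaev p u η 0 = 0 := by
    simp [pohozaev, Real.zero_rpow (by linarith : p - 2 ≠ 0)]
  have hd := fun x hx => (hsys x hx).hasDerivAt_pohozaev (by linarith) hx
  have hpp : 0 < (p - 5) / (2 * (p + 1)) := div_pos (by linarith) (by linarith)
  have hmono : MonotoneOn (pohozaev p u η) (Ici 0) := by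
    refine monotoneOn_of_deriv_nonneg (convex_Ici _) hQc.continuousOn ?_ ?_
    · rw [interior_Ici]
      exact fun x hx => (hd x hx).differentiableAt.differentiableWithinAt
    · rw [interior_Ici]
      intro x hx
      rw [(hd x hx).deriv]
      have := Real.rpow_nonneg (le_of_lt hx) (p - 3)
      positivity
  obtain ⟨δ, hδ, hne⟩ := Metric.eventually_nhds_iff.1
    (hu.continuousAt.eventually_ne (x := 0) (by rwa [hu0]) : ∀ᶠ x in 𝓝 (0 : ℝ), u x ≠ 0)
  have hδ2 : 0 < δ / 2 := by positivity
  have hstrict : StrictMonoOn (pohozaev p u η) (Icc 0 (δ / 2)) := by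
    refine strictMonoOn_of_deriv_pos (convex_Icc _ _) hQc.continuousOn ?_
    rw [interior_Icc]
    intro x hx
    rw [(hd x hx.1).deriv]
    have h1 : u x ≠ 0 := hne (by
      rw [Real.dist_eq, sub_zero, abs_of_pos hx.1]
      linarith [hx.2])
    have h2 := Real.rpow_pos_of_pos hx.1 (p - 3)
    have h3 : 0 < |u x| ^ (p + 1) := Real.rpow_pos_of_pos (abs_pos.2 h1) _
    positivity
  refine ⟨pohozaev p u η (δ / 2), δ / 2, ?_, hδ2, fun x hx =>
    hmono (mem_Ici.2 hδ2.le) (mem_Ici.2 (hδ2.le.trans hx)) hx⟩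
  have := hstrict (left_mem_Icc.2 hδ2.le) (right_mem_Icc.2 hδ2.le) hδ2
  rwa [hQ0] at this

theorem abs_rpow_le_one_add {s q : ℝ} (hs : 0 ≤ s) (hsq : s ≤ q) (t : ℝ) :
    |t| ^ s ≤ 1 + |t| ^ q := by
  rcases le_total |t| 1 with h | h
  · have := Real.rpow_le_one (abs_nonneg t) h hs
    have := Real.rpow_nonneg (abs_nonneg t) q
    linarith
  · linarith [Real.rpow_le_rpow_of_exponent_le h hsq]

open Set in
/-- A localized virial estimate: a lower bound for the Pohozaev functional on `[1, 2]` is controlled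
by the `L^q` norm of the solution there. With `φ = ((x - 1) (2 - x)) ^ 2`, the function
`F = φ u η / 2 - x u² φ' / 4` vanishes at both endpoints, and `F'` is `φ pohozaev / x²` up to terms
of order `|u| ^ (p + 1)` and `u²` only, without `η`. -/
theorem pohozaev_le_integral {p q : ℝ} (hp : 5 < p) (hq : p + 1 ≤ q) {u η : ℝ → ℝ}
    (hsys : ∀ x ∈ Icc (1 : ℝ) 2, InvertedSystemAt p u η x) {k : ℝ} (hk0 : 0 ≤ k)
    (hk : ∀ x ∈ Icc (1 : ℝ) 2, k ≤ pohozaev p u η x) :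
    k ≤ 120 * (2 ^ (p - 4) + 2) * (1 + ∫ x in (1 : ℝ)..2, |u x| ^ q) := by
  set C : ℝ := 2 ^ (p - 4) + 2 with hC
  set φ : ℝ → ℝ := fun x => ((x - 1) * (2 - x)) ^ 2 with hφ
  set φ₁ : ℝ → ℝ := fun x => 2 * ((x - 1) * (2 - x)) * (3 - 2 * x) with hφ₁
  set φ₂ : ℝ → ℝ := fun x => 2 * (3 - 2 * x) ^ 2 - 4 * ((x - 1) * (2 - x)) with hφ₂
  have hid := fun x : ℝ => hasDerivAt_id' x
  have hb : ∀ x : ℝ, HasDerivAt (fun x : ℝ => (x - 1) * (2 - x)) (3 - 2 * x) x := fun x =>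
    (((hid x).sub_const 1).mul ((hid x).const_sub 2)).congr_deriv (by ring)
  have hd1 : ∀ x : ℝ, HasDerivAt φ (φ₁ x) x := fun x =>
    ((hb x).pow 2).congr_deriv (by simp only [hφ₁]; norm_num)
  have hd2 : ∀ x : ℝ, HasDerivAt φ₁ (φ₂ x) x := fun x =>
    (((hb x).const_mul 2).mul (((hid x).const_mul 2).const_sub 3)).congr_deriv (by
      simp only [hφ₂]; ring)
  have huc : ContinuousOn u (Icc 1 2) := fun x hx =>
    (hsys x hx).left.continuousAt.continuousWithinAt
  set F : ℝ → ℝ := fun x => φ x * u x * η x / 2 - x * u x ^ 2 * φ₁ x / 4 with hF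
  set F' : ℝ → ℝ := fun x => φ x * (pohozaev p u η x / x ^ 2 -
    (1 / (p + 1) + 1 / 2) * (x ^ (p - 4) * |u x| ^ (p + 1))) +
      u x ^ 2 * (φ₁ x - x * φ₂ x) / 4 with hF'
  have hFd : ∀ x ∈ Icc (1 : ℝ) 2, HasDerivAt F (F' x) x := by
    intro x hx
    have hx0 : 0 < x := by linarith [hx.1]
    have h1 := ((((hd1 x).mul (hsys x hx).left).mul (hsys x hx).right).div_const 2)
    have h2 := ((((hid x).mul ((hsys x hx).left.pow 2)).mul (hd2 x)).div_const 4)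
    refine (h1.sub h2).congr_deriv ?_
    have e2 : x ^ (p - 2) = x ^ (p - 4) * x * x := by
      rw [← Real.rpow_add_one hx0.ne', ← Real.rpow_add_one hx0.ne']; ring_nf
    have hp1 : p + 1 ≠ 0 := by linarith
    simp only [hF', pohozaev, Pi.mul_apply, Pi.pow_apply, Nat.cast_ofNat]
    rw [e2, ← abs_rpow_sub_one_mul_mul_self (by linarith : 1 < p)]
    field_simp
    ring
  have hqc : ContinuousOn (fun x => |u x| ^ q) (Icc 1 2) :=
    huc.abs.rpow_const fun x _ => Or.inr (by linarith)
  have hφc : Continuous φ := by fun_prop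
  have hqi : IntervalIntegrable (fun x => |u x| ^ q) volume 1 2 :=
    ContinuousOn.intervalIntegrable (by rwa [uIcc_of_le one_le_two])
  have hineq : ∀ x ∈ Ioo (1 : ℝ) 2, k / 4 * φ x - C * (1 + |u x| ^ q) ≤ F' x := by
    intro x hx
    have hx' : x ∈ Icc (1 : ℝ) 2 := ⟨hx.1.le, hx.2.le⟩
    have hx0 : 0 < x := by linarith [hx.1]
    have hb0 : 0 ≤ (x - 1) * (2 - x) := mul_nonneg (by linarith [hx.1]) (by linarith [hx.2])
    have hb1 : (x - 1) * (2 - x) ≤ 1 := by nlinarith [hx.1, hx.2]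
    have hφ0 : 0 ≤ φ x := sq_nonneg _
    have hφ1 : φ x ≤ 1 := pow_le_one₀ hb0 hb1
    have hU0 : 0 ≤ |u x| ^ (p + 1) := Real.rpow_nonneg (abs_nonneg _) _
    have hU1 := abs_rpow_le_one_add (by linarith : 0 ≤ p + 1) hq (u x)
    have hU2 : u x ^ 2 ≤ 1 + |u x| ^ q := by
      have := abs_rpow_le_one_add (by norm_num : (0 : ℝ) ≤ 2) (by linarith : 2 ≤ q) (u x)
      rwa [Real.rpow_two, sq_abs] at this
    have h1 : k / 4 * φ x ≤ φ x * (pohozaev p u η x / x ^ 2) := by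
      rw [mul_comm]
      refine mul_le_mul_of_nonneg_left ?_ hφ0
      rw [le_div_iff₀ (by positivity)]
      have : x ^ 2 ≤ 4 := by nlinarith [hx.1, hx.2]
      nlinarith [hk x hx']
    have hX0 : 0 ≤ x ^ (p - 4) := Real.rpow_nonneg hx0.le _
    have hX1 : x ^ (p - 4) ≤ 2 ^ (p - 4) :=
      Real.rpow_le_rpow hx0.le hx.2.le (by linarith)
    have hκ0 : 0 ≤ 1 / (p + 1) + 1 / 2 := by
      have : 0 < p + 1 := by linarith
      positivity
    have hκ1 : 1 / (p + 1) + 1 / 2 ≤ 1 := by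
      have : 1 / (p + 1) ≤ 1 / 2 := one_div_le_one_div_of_le (by norm_num) (by linarith)
      linarith
    have h2 : φ x * ((1 / (p + 1) + 1 / 2) * (x ^ (p - 4) * |u x| ^ (p + 1))) ≤
        2 ^ (p - 4) * (1 + |u x| ^ q) := by
      calc _ ≤ 1 * (1 * (2 ^ (p - 4) * (1 + |u x| ^ q))) := by gcongr
        _ = _ := by ring
    have h3 : -(2 * (1 + |u x| ^ q)) ≤ u x ^ 2 * (φ₁ x - x * φ₂ x) / 4 := by
      have h4 : -8 ≤ φ₁ x - x * φ₂ x := by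
        simp only [hφ₁, hφ₂]
        nlinarith [hx.1, hx.2, mul_nonneg hb0 hx0.le, mul_nonneg hb0 (sq_nonneg (3 - 2 * x))]
      nlinarith [sq_nonneg (u x)]
    simp only [hF', hC, mul_sub]
    linarith
  have hφi : IntervalIntegrable (fun x => k / 4 * φ x) volume 1 2 :=
    (hφc.intervalIntegrable _ _).const_mul _
  have hlower : IntervalIntegrable (fun x => k / 4 * φ x - C * (1 + |u x| ^ q)) volume 1 2 :=
    hφi.sub ((intervalIntegrable_const.add hqi).const_mul C)
  have hmain := intervalIntegral.integral_le_sub_of_hasDeriv_right_of_le one_le_two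
    (fun x hx => (hFd x hx).continuousAt.continuousWithinAt)
    (fun x hx => (hFd x ⟨hx.1.le, hx.2.le⟩).hasDerivWithinAt)
    ((intervalIntegrable_iff_integrableOn_Icc_of_le one_le_two).1 hlower) hineq
  have hends : F 2 - F 1 = 0 := by simp [hF, hφ, hφ₁]
  have hφint : ∫ x in (1 : ℝ)..2, φ x = 1 / 30 := by
    have : ∀ x ∈ uIcc (1 : ℝ) 2, HasDerivAt
        (fun x : ℝ => (x - 1) ^ 3 / 3 - (x - 1) ^ 4 / 2 + (x - 1) ^ 5 / 5) (φ x) x := fun x _ => by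
      have h := (hid x).sub_const 1
      refine ((((h.pow 3).div_const 3).sub ((h.pow 4).div_const 2)).add
        ((h.pow 5).div_const 5)).congr_deriv ?_
      simp only [hφ]
      push_cast
      ring
    rw [intervalIntegral.integral_eq_sub_of_hasDerivAt this (hφc.intervalIntegrable _ _)]
    norm_num
  rw [hends, intervalIntegral.integral_sub hφi
    ((intervalIntegrable_const.add hqi).const_mul C), intervalIntegral.integral_const_mul,
    intervalIntegral.integral_const_mul, hφint,
    intervalIntegral.integral_add intervalIntegrable_const hqi] at hmain
  simp only [intervalIntegral.integral_const, smul_eq_mul] at hmain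
  norm_num at hmain
  linarith

/-- The scaling invariance of the inverted system. -/
theorem InvertedSystemAt.rescale {p b X s : ℝ} (hb : b * (p - 1) = p - 3) (hX : 0 < X) (hs : 0 < s)
    {u η : ℝ → ℝ} (h : InvertedSystemAt p u η (X * s)) :
    InvertedSystemAt p (fun s => X ^ b * u (X * s)) (fun s => X ^ b * η (X * s)) s := by
  have hX' : HasDerivAt (fun s => X * s) X s := by
    simpa using (hasDerivAt_id s).const_mul X
  constructor
  · refine ((h.left.comp s hX').const_mul (X ^ b)).congr_deriv ?_
    field_simp
  · refine ((h.right.comp s hX').const_mul (X ^ b)).congr_deriv ?_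
    have hXb : 0 ≤ X ^ b := by positivity
    rw [abs_mul, abs_of_nonneg hXb, Real.mul_rpow hXb (abs_nonneg _), ← Real.rpow_mul hX.le, hb,
      Real.mul_rpow hX.le hs.le, show p - 3 = p - 4 + 1 by ring, Real.rpow_add_one hX.ne']
    ring

theorem pohozaev_rescale {p b X s : ℝ} (hb : b * (p - 1) = p - 3) (hX : 0 < X) (hs : 0 < s)
    (u η : ℝ → ℝ) :
    pohozaev p (fun s => X ^ b * u (X * s)) (fun s => X ^ b * η (X * s)) s =
      X ^ (2 * b - 1) * pohozaev p u η (X * s) := by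
  have hXb : 0 ≤ X ^ b := by positivity
  have e1 : X ^ (2 * b - 1) * X = X ^ b * X ^ b := by
    rw [← Real.rpow_add_one hX.ne', ← Real.rpow_add hX]
    ring_nf
  have e2 : (X ^ b) ^ (p + 1) = X ^ (2 * b - 1) * X ^ (p - 2) := by
    rw [← Real.rpow_mul hX.le, ← Real.rpow_add hX]
    congr 1
    linarith
  simp only [pohozaev]
  rw [abs_mul, abs_of_nonneg hXb, Real.mul_rpow hXb (abs_nonneg _), Real.mul_rpow hX.le hs.le, e2]
  linear_combination (-(s * η (X * s) ^ 2 / 2) + s * u (X * s) * η (X * s) / 2) * e1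

open Set in
/-- On `[X, 2 X]`, rescaled to `[1, 2]`, the Pohozaev functional is at least of size
`X ^ ((p - 5) / (p - 1))`, while the scale-invariant norm stays bounded if it is finite. -/
theorem not_integrableOn_of_pohozaev_pos {p c x₀ : ℝ} (hp : 5 < p) (hc : 0 < c) (hx₀ : 0 < x₀)
    {u η : ℝ → ℝ} (hsys : ∀ x, 0 < x → InvertedSystemAt p u η x)
    (hpos : ∀ x, x₀ ≤ x → c ≤ pohozaev p u η x) :
    ¬ IntegrableOn (fun x => x ^ (3 * (p - 1) / 2 - 4) * |u x| ^ (3 * (p - 1) / 2)) (Ioi 0) := by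
  intro hint
  set q : ℝ := 3 * (p - 1) / 2 with hq
  set I : ℝ := ∫ x in Ioi (0 : ℝ), x ^ (q - 4) * |u x| ^ q with hI
  set b : ℝ := (p - 3) / (p - 1) with hbdef
  have hp1 : p - 1 ≠ 0 := by linarith
  have hb : b * (p - 1) = p - 3 := by rw [hbdef]; field_simp
  have hb2 : 0 < 2 * b - 1 := by
    rw [show 2 * b - 1 = (p - 5) / (p - 1) by rw [hbdef]; field_simp; ring]
    exact div_pos (by linarith) (by linarith)
  have hbq : b * q = q - 3 := by rw [hq]; linear_combination (3 / 2) * hb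
  have hscale : ∀ X, x₀ ≤ X → ∫ s in (1 : ℝ)..2, |X ^ b * u (X * s)| ^ q ≤ I := by
    intro X hXx
    have hX : 0 < X := hx₀.trans_le hXx
    have hXb : 0 ≤ X ^ b := by positivity
    have hcont : ContinuousOn u (Icc X (2 * X)) := fun x hx =>
      (hsys x (hX.trans_le hx.1)).left.continuousAt.continuousWithinAt
    have h2X : X ≤ 2 * X := by linarith
    have hcq : ContinuousOn (fun x => |u x| ^ q) (Icc X (2 * X)) :=
      hcont.abs.rpow_const fun x _ => Or.inr (by rw [hq]; linarith)
    have hsub : Ioc X (2 * X) ⊆ Ioi 0 := fun x hx => hX.trans hx.1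
    calc ∫ s in (1 : ℝ)..2, |X ^ b * u (X * s)| ^ q
        = ∫ s in (1 : ℝ)..2, X ^ (q - 3) * |u (X * s)| ^ q := by
          refine intervalIntegral.integral_congr fun s _ => ?_
          rw [abs_mul, abs_of_nonneg hXb, Real.mul_rpow hXb (abs_nonneg _), ← Real.rpow_mul hX.le,
            hbq]
      _ = ∫ x in X..2 * X, X ^ (q - 4) * |u x| ^ q := by
          rw [intervalIntegral.integral_const_mul, intervalIntegral.integral_const_mul,
            intervalIntegral.integral_comp_mul_left (fun x => |u x| ^ q) hX.ne',
            show q - 3 = q - 4 + 1 by ring, Real.rpow_add_one hX.ne', mul_one, mul_comm X 2,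
            smul_eq_mul]
          field_simp
      _ = ∫ x in Ioc X (2 * X), X ^ (q - 4) * |u x| ^ q := intervalIntegral.integral_of_le h2X
      _ ≤ ∫ x in Ioc X (2 * X), x ^ (q - 4) * |u x| ^ q := by
          refine setIntegral_mono_on ?_ (hint.mono_set hsub) measurableSet_Ioc fun x hx => ?_
          · exact ((continuousOn_const.mul hcq).integrableOn_Icc).mono_set Ioc_subset_Icc_self
          · have h1 : X ^ (q - 4) ≤ x ^ (q - 4) :=
              Real.rpow_le_rpow hX.le hx.1.le (by rw [hq]; linarith)
            have h2 : 0 ≤ |u x| ^ q := by positivity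
            gcongr
      _ ≤ I := by
          refine setIntegral_mono_set hint ?_ hsub.eventuallyLE
          filter_upwards [ae_restrict_mem measurableSet_Ioi] with x hx
          exact mul_nonneg (Real.rpow_nonneg (le_of_lt hx) _) (by positivity)
  have hbdd : ∀ X, x₀ ≤ X → X ^ (2 * b - 1) * c ≤ 120 * (2 ^ (p - 4) + 2) * (1 + I) := by
    intro X hXx
    have hX : 0 < X := hx₀.trans_le hXx
    refine (pohozaev_le_integral hp (q := q) (by rw [hq]; linarith)
      (u := fun s => X ^ b * u (X * s)) (η := fun s => X ^ b * η (X * s)) ?_ (by positivity)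
      ?_).trans ?_
    · intro s hs
      have hs0 : 0 < s := by linarith [hs.1]
      exact (hsys _ (by positivity)).rescale hb hX hs0
    · intro s hs
      have hs0 : 0 < s := by linarith [hs.1]
      rw [pohozaev_rescale hb hX hs0]
      have := hpos (X * s) (by nlinarith [hs.1])
      gcongr
    · have := hscale X hXx
      gcongr
  have htop : Tendsto (fun X : ℝ => X ^ (2 * b - 1) * c) atTop atTop :=
    (tendsto_rpow_atTop hb2).atTop_mul_const hc
  obtain ⟨X, hX1, hX2⟩ := ((htop.eventually_gt_atTop
    (120 * (2 ^ (p - 4) + 2) * (1 + I))).and (eventually_ge_atTop x₀)).exists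
  exact absurd (hbdd X hX2) (not_le.2 hX1)

/-- Polar coordinates followed by the inversion `r = 1 / x`. -/
theorem integrableOn_of_memLp_norm_inv {p : ℝ} (hp : 1 < p) {y u : ℝ → ℝ}
    (hyu : ∀ x, 0 ≤ x → y x = x * u x)
    (h : MemLp (fun w : R3 => y ‖w‖⁻¹) (ENNReal.ofReal (3 * (p - 1) / 2)) volume) :
    IntegrableOn (fun x => x ^ (3 * (p - 1) / 2 - 4) * |u x| ^ (3 * (p - 1) / 2))
      (Set.Ioi 0) := by
  set q : ℝ := 3 * (p - 1) / 2 with hq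
  have hq0 : 0 < q := by rw [hq]; linarith
  have h1 := h.integrable_norm_rpow (by simpa using hq0) ENNReal.ofReal_ne_top
  rw [ENNReal.toReal_ofReal hq0.le] at h1
  have h2 := (integrable_fun_norm_addHaar (volume : Measure R3)
    (f := fun r => ‖y r⁻¹‖ ^ q)).1 h1
  rw [← integrableOn_Ioi_comp_rpow_iff _ (by norm_num : (-1 : ℝ) ≠ 0)] at h2
  refine h2.congr_fun (fun x hx => ?_) measurableSet_Ioi
  have hx0 : 0 < x := hx
  have e : x ^ q = x ^ (q - 4) * x ^ 4 := by
    rw [← Real.rpow_natCast, ← Real.rpow_add hx0]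
    norm_num
  simp only [finrank_euclideanSpace, Fintype.card_fin, smul_eq_mul, Real.rpow_neg_one, inv_inv,
    abs_neg, abs_one, one_mul, Real.norm_eq_abs]
  rw [hyu x hx0.le, abs_mul, abs_of_pos hx0, Real.mul_rpow hx0.le (abs_nonneg _), e,
    show (-1 : ℝ) - 1 = -(2 : ℕ) by norm_num, Real.rpow_neg hx0.le, Real.rpow_natCast,
    show 3 - 1 = 2 from rfl]
  field_simp

/-! ### Existence of the singular solution -/

theorem proposition3p2 (p : ℝ) (hp : 5 < p) (l : ℝ) (hl : l ≠ 0) :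
    ∃ (Z : R3 → ℝ) (z : ℝ → ℝ),
      HasRadialProfile Z z ∧
      IsPuncturedSolution p Z ∧
      (∃ C : ℝ, ∀ r : ℝ, 1 ≤ r → |r * z r - l| ≤ C / r ^ 2) ∧
      Tendsto (fun r : ℝ => r ^ 2 * deriv z r) atTop (𝓝 (-l)) ∧
      ¬ MemLp Z (ENNReal.ofReal (3 * (p - 1) / 2)) volume := by
  obtain ⟨u, y, η, hu, hyC, hy, hη, hyu, hu0, hη0, hsys, C, hC⟩ := exists_inverted_solution hp hl
  obtain ⟨c, x₀, hc, hx₀, hpos⟩ := exists_pohozaev_lower_bound hp hl hu hη hu0 hsys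
  refine ⟨fun w => y ‖w‖⁻¹, fun r => y r⁻¹, fun _ _ => rfl, ⟨?_, ?_⟩, ⟨C, ?_⟩, ?_, fun h =>
    not_integrableOn_of_pohozaev_pos hp hc hx₀ hsys hpos
      (integrableOn_of_memLp_norm_inv (by linarith) hyu h)⟩
  · intro x hx
    have hx' : x ≠ 0 := hx
    exact (hyC.contDiffAt.comp x
      ((contDiffAt_norm ℝ hx').inv (norm_ne_zero_iff.2 hx'))).contDiffWithinAt
  · intro x hx
    have hρ : 0 < ‖x‖⁻¹ := inv_pos.2 (norm_pos_iff.2 hx)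
    rw [laplacian_comp_norm_inv hx hy (hsys _ hρ).right, hyu _ hρ.le]
    set ρ := ‖x‖⁻¹
    have e : ρ ^ (p - 1) * ρ = ρ ^ 4 * ρ ^ (p - 4) := by
      rw [← Real.rpow_add_one hρ.ne', ← Real.rpow_natCast ρ 4, ← Real.rpow_add hρ]
      norm_num
    rw [abs_mul, abs_of_pos hρ, Real.mul_rpow hρ.le (abs_nonneg _)]
    linear_combination (|u ρ| ^ (p - 1) * u ρ) * e
  · intro r hr
    have hr0 : 0 < r := by linarith
    have hC0 : 0 ≤ C := by simpa using (abs_nonneg _).trans (hC 1 zero_le_one)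
    have h1 : r * (r⁻¹ * u r⁻¹) = u r⁻¹ := by field_simp
    change |r * y r⁻¹ - l| ≤ C / r ^ 2
    rw [hyu _ (inv_nonneg.2 hr0.le), h1]
    refine (hC _ (inv_nonneg.2 hr0.le)).trans ?_
    rw [div_eq_mul_inv, ← inv_pow]
    refine mul_le_mul_of_nonneg_left ?_ hC0
    rw [← Real.rpow_natCast r⁻¹ 2]
    -- here `5 < p` makes the decay rate `r ^ (3 - p)` better than `r ^ (-2)`
    exact Real.rpow_le_rpow_of_exponent_ge (inv_pos.2 hr0) (inv_le_one_of_one_le₀ hr)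
      (by push_cast; linarith)
  · have h1 : Tendsto (fun r : ℝ => -η r⁻¹) atTop (𝓝 (-l)) := by
      have := (hη.tendsto 0).comp tendsto_inv_atTop_zero
      rw [hη0] at this
      exact this.neg
    refine h1.congr' ?_
    filter_upwards [eventually_gt_atTop 0] with r hr
    have hd : HasDerivAt (fun r => y r⁻¹) (η r⁻¹ * -(r ^ 2)⁻¹) r :=
      (hy r⁻¹).comp r (hasDerivAt_inv hr.ne')
    rw [hd.deriv]
    field_simp
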